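/- A Boolean frame is a Boolean algebra $A$ (one-element algebras allowed) with an arbitrary unary operation $f:A\to A$. It is normal if $f(0)=0$, unit-preserving if $f(1)=1$, extensive if $x\le f(x)$, monotone if $f(x)\sqcup f(y)\le f(x\sqcup y)$, and idempotent if $f(f(x))=f(x)$, for all $x,y\in A$; a class of Boolean frames has one of these properties if all its members do. A variety is a class of Boolean frames closed under homomorphic images ($\mathbf H$), subalgebras ($\mathbf S$) and direct products ($\mathbf P$), subalgebras and products being taken up to isomorphism; it is nontrivial if it has a member with more than one element. A Boolean frame has the congruence extension property (CEP) if every congruence of each of its subalgebras is the restriction of a congruence of the whole algebra; a class has the CEP if all its members do. For a Boolean frame $\mathfrak A=(A,f)$ let $\mathfrak A^*$ be the Boolean algebra $A\times A$ with $f^*(a,b)=(f(a),f(b))$ if $a=0$ or $b=0$, and $f^*(a,b)=(1,1)$ otherwise. For a variety $\mathbf V$ put $\mathbf V^*=\mathbf{HSP}\{\mathfrak A^*:\mathfrak A\in\mathbf V\}$. Theorem. Let $\mathbf V$ and $\mathbf U$ be varieties of normal, unit-preserving Boolean frames. Then: (0) $\mathbf V^*$ is a variety of normal, unit-preserving Boolean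 frames. (i) If $\mathbf V$ is nontrivial, then $\mathbf V^*$ does not have the CEP. (ii) If $\mathbf V\ne\mathbf U$, then $\mathbf V^*\neq\mathbf U^*$. (iii) $\mathbf V^*$ is extensive if and only if $\mathbf V$ is; $\mathbf V^*$ is monotone if and only if $\mathbf V$ is; $\mathbf V^*$ is idempotent if and only if $\mathbf V$ is. -/

import Mathlib

universe u

/-- A Boolean frame: a Boolean algebra together with an arbitrary unary operation `op`.
The one-element Boolean algebra is allowed. -/
structure BooleanFrame : Type (u + 1) where
  carrier : Type u
  str : BooleanAlgebra carrier
  op : carrier → carrier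

namespace BooleanFrame

instance : CoeSort BooleanFrame.{u} (Type u) := ⟨BooleanFrame.carrier⟩

instance (A : BooleanFrame.{u}) : BooleanAlgebra A := A.str

/-- Homomorphisms in the signature `⊓`, complement, `0`, `op`. -/
structure IsHom {A B : BooleanFrame.{u}} (φ : A → B) : Prop where
  map_inf : ∀ x y : A, φ (x ⊓ y) = φ x ⊓ φ y
  map_compl : ∀ x : A, φ xᶜ = (φ x)ᶜ
  map_bot : φ ⊥ = ⊥
  map_op : ∀ x : A, φ (A.op x) = B.op (φ x)

/-- The direct product of a family of Boolean frames, with coordinatewise operations. -/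
def pi {I : Type u} (A : I → BooleanFrame.{u}) : BooleanFrame.{u} where
  carrier := ∀ i, A i
  str := inferInstance
  op := fun x i => (A i).op (x i)

/-- Subalgebras: Boolean subalgebras that are closed under `op`. -/
structure Subframe (A : BooleanFrame.{u}) extends BooleanSubalgebra A where
  op_mem : ∀ x ∈ toBooleanSubalgebra, A.op x ∈ toBooleanSubalgebra

/-- A subalgebra as a Boolean frame in its own right, with the restricted operations. -/
def Subframe.toFrame {A : BooleanFrame.{u}} (B : Subframe A) : BooleanFrame.{u} where
  carrier := B.toBooleanSubalgebra
  str := inferInstance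
  op := fun x => ⟨A.op x.1, B.op_mem x.1 x.2⟩

/-- The inclusion of a subalgebra. -/
def Subframe.incl {A : BooleanFrame.{u}} (B : Subframe A) (x : B.toFrame) : A := x.1

/-- Congruences: equivalence relations compatible with `⊓`, complement and `op`. -/
structure Congruence (A : BooleanFrame.{u}) extends Setoid A where
  inf_compat : ∀ {x x' y y' : A}, r x x' → r y y' → r (x ⊓ y) (x' ⊓ y')
  compl_compat : ∀ {x x' : A}, r x x' → r xᶜ x'ᶜ
  op_compat : ∀ {x x' : A}, r x x' → r (A.op x) (A.op x')

/-- The congruence extension property of a single algebra: every congruence of every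
subalgebra is the restriction of a congruence of the whole algebra. -/
def HasCEP (A : BooleanFrame.{u}) : Prop :=
  ∀ (B : Subframe A) (Θ : Congruence B.toFrame), ∃ Ψ : Congruence A,
    ∀ x y : B.toFrame, Θ.r x y ↔ Ψ.r (B.incl x) (B.incl y)

def IsNormal (A : BooleanFrame.{u}) : Prop := A.op ⊥ = ⊥

def IsUnitPreserving (A : BooleanFrame.{u}) : Prop := A.op ⊤ = ⊤

def IsExtensive (A : BooleanFrame.{u}) : Prop := ∀ x : A, x ≤ A.op x

def IsMonotone (A : BooleanFrame.{u}) : Prop :=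
  ∀ x y : A, A.op x ⊔ A.op y ≤ A.op (x ⊔ y)

def IsIdempotent (A : BooleanFrame.{u}) : Prop := ∀ x : A, A.op (A.op x) = A.op x

open Classical in
/-- The algebra `A*` on `A × A`. -/
noncomputable def star (A : BooleanFrame.{u}) : BooleanFrame.{u} where
  carrier := A × A
  str := inferInstance
  op := fun p => if p.1 = ⊥ ∨ p.2 = ⊥ then (A.op p.1, A.op p.2) else (⊤, ⊤)

/-- `H K`: homomorphic images of members of `K`. -/
def H (K : Set BooleanFrame.{u}) : Set BooleanFrame.{u} :=
  {B | ∃ A ∈ K, ∃ φ : A → B, IsHom φ ∧ Function.Surjective φ}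

/-- `S K`: algebras isomorphic to a subalgebra of (that is, embeddable into) a member of `K`. -/
def S (K : Set BooleanFrame.{u}) : Set BooleanFrame.{u} :=
  {B | ∃ A ∈ K, ∃ φ : B → A, IsHom φ ∧ Function.Injective φ}

/-- `P K`: algebras isomorphic to a direct product of a (possibly empty) family in `K`. -/
def P (K : Set BooleanFrame.{u}) : Set BooleanFrame.{u} :=
  {B | ∃ (I : Type u) (A : I → BooleanFrame.{u}), (∀ i, A i ∈ K) ∧
    ∃ φ : B → pi A, IsHom φ ∧ Function.Bijective φ}

/-- A variety: a class of Boolean frames closed under homomorphic images, subalgebras and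
direct products (it contains the one-element frames, as the empty product). -/
structure IsVariety (V : Set BooleanFrame.{u}) : Prop where
  closed_H : H V ⊆ V
  closed_S : S V ⊆ V
  closed_P : P V ⊆ V

/-- `V* = HSP {A* : A ∈ V}`. -/
def starVariety (V : Set BooleanFrame.{u}) : Set BooleanFrame.{u} :=
  H (S (P {B | ∃ A ∈ V, B = star A}))

/-- A variety of normal and unit-preserving Boolean frames. -/
structure IsNUVariety (V : Set BooleanFrame.{u}) : Prop where
  isVariety : IsVariety V
  normal : ∀ A ∈ V, IsNormal A
  unitPreserving : ∀ A ∈ V, IsUnitPreserving A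

end BooleanFrame

/-! On the axes `A × ⊥` and `⊥ × A` of `star A` the operation is that of `A`; off them it is
constantly `⊤`. So identities pass between `A` and `star A`, and `HSP` preserves them.

The CEP fails because a congruence gluing `(⊤, ⊥)` to `⊤` must identify each `(f c, ⊥)`, `c ≠ ⊥`,
with `⊤`; two complementary fixed points `c` then collapse everything, while the projection kernel
on the four corners is proper (`not_hasCEP_star`).

For injectivity, `V` is recovered from `V*`. A term, `cornerTerm`, always evaluates to `⊥` or to an
axis corner in a star algebra, and can be made to equal `(⊤, ⊥)`. If `star A` is a quotient of a
subalgebra of a product of stars `star (B i)`, relativizing to such a term cuts each factor down to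
`B i` or to nothing and `star A` down to `A`, so `A` lies in the variety of the `B i`
(`mem_of_star_mem`).

Both arguments need a nontrivial fixed point; the corner `(⊤, ⊥)` of `square A` supplies it. -/

namespace BooleanFrame

/-! ### Homomorphisms and subalgebras -/

section Hom

variable {A B C : BooleanFrame.{u}}

lemma IsHom.map_sup {φ : A → B} (h : IsHom φ) (x y : A) : φ (x ⊔ y) = φ x ⊔ φ y := by
  rw [← compl_inj_iff, ← h.map_compl, compl_sup, compl_sup, h.map_inf, h.map_compl, h.map_compl]

lemma IsHom.map_top {φ : A → B} (h : IsHom φ) : φ ⊤ = ⊤ := by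
  rw [← compl_bot, h.map_compl, h.map_bot, compl_bot]

lemma IsHom.map_sdiff {φ : A → B} (h : IsHom φ) (x y : A) : φ (x \ y) = φ x \ φ y := by
  rw [sdiff_eq, sdiff_eq, h.map_inf, h.map_compl]

lemma IsHom.comp {ψ : B → C} {φ : A → B} (hψ : IsHom ψ) (hφ : IsHom φ) :
    IsHom (fun x => ψ (φ x)) where
  map_inf x y := by rw [hφ.map_inf, hψ.map_inf]
  map_compl x := by rw [hφ.map_compl, hψ.map_compl]
  map_bot := by rw [hφ.map_bot, hψ.map_bot]
  map_op x := by rw [hφ.map_op, hψ.map_op]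

lemma IsHom.id : IsHom (fun x : A => x) := ⟨fun _ _ => rfl, fun _ => rfl, rfl, fun _ => rfl⟩

lemma Subframe.isHom_incl (B : Subframe A) : IsHom B.incl :=
  ⟨fun _ _ => rfl, fun _ => rfl, rfl, fun _ => rfl⟩

lemma Subframe.incl_injective (B : Subframe A) : Function.Injective B.incl :=
  fun _ _ h => Subtype.ext h

lemma isHom_eval {I : Type u} (A : I → BooleanFrame.{u}) (i : I) :
    IsHom (fun x : pi A => (x i : A i)) :=
  ⟨fun _ _ => rfl, fun _ => rfl, rfl, fun _ => rfl⟩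

lemma isHom_pi {I : Type u} {A : I → BooleanFrame.{u}} {φ : ∀ i, B → A i}
    (h : ∀ i, IsHom (φ i)) : IsHom (B := pi A) (fun x i => φ i x) where
  map_inf x y := funext fun i => (h i).map_inf x y
  map_compl x := funext fun i => (h i).map_compl x
  map_bot := funext fun i => (h i).map_bot
  map_op x := funext fun i => (h i).map_op x

/-- The preimage under `φ` of the range of `ι`. -/
def pullback {φ : A → C} (hφ : IsHom φ) {ι : B → C} (hι : IsHom ι) : Subframe A where
  carrier := {a | ∃ b, ι b = φ a}
  supClosed' := by
    rintro x ⟨a, ha⟩ y ⟨b, hb⟩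
    exact ⟨a ⊔ b, by rw [hι.map_sup, hφ.map_sup, ha, hb]⟩
  infClosed' := by
    rintro x ⟨a, ha⟩ y ⟨b, hb⟩
    exact ⟨a ⊓ b, by rw [hι.map_inf, hφ.map_inf, ha, hb]⟩
  compl_mem' := by
    rintro x ⟨a, ha⟩
    exact ⟨aᶜ, by rw [hι.map_compl, hφ.map_compl, ha]⟩
  bot_mem' := ⟨⊥, by rw [hι.map_bot, hφ.map_bot]⟩
  op_mem := by
    rintro x ⟨a, ha⟩
    exact ⟨B.op a, by rw [hι.map_op, hφ.map_op, ha]⟩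

end Hom

/-! ### `HSP` classes are varieties -/

section HSP

variable {K V : Set BooleanFrame.{u}} {B : BooleanFrame.{u}}

lemma mem_HSP_iff : B ∈ H (S (P K)) ↔ ∃ (I : Type u) (A : I → BooleanFrame.{u})
    (C : BooleanFrame.{u}) (ι : C → pi A) (φ : C → B), (∀ i, A i ∈ K) ∧
    IsHom ι ∧ Function.Injective ι ∧ IsHom φ ∧ Function.Surjective φ := by
  constructor
  · rintro ⟨C, ⟨D, ⟨I, A, hA, χ, hχ, hχ'⟩, ι, hι, hι'⟩, φ, hφ, hφ'⟩
    exact ⟨I, A, C, _, φ, hA, hχ.comp hι, hχ'.1.comp hι', hφ, hφ'⟩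
  · rintro ⟨I, A, C, ι, φ, hA, hι, hι', hφ, hφ'⟩
    exact ⟨C, ⟨pi A, ⟨I, A, hA, _, IsHom.id, Function.bijective_id⟩, ι, hι, hι'⟩, φ, hφ, hφ'⟩

lemma subset_HSP : K ⊆ H (S (P K)) := fun A hA =>
  mem_HSP_iff.2 ⟨PUnit, fun _ => A, A, fun a _ => a, fun a => a, fun _ => hA,
    isHom_pi fun _ => IsHom.id, fun _ _ h => congrFun h PUnit.unit, IsHom.id,
    Function.surjective_id⟩

lemma isVariety_HSP (K : Set BooleanFrame.{u}) : IsVariety (H (S (P K))) where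
  closed_H := by
    rintro B ⟨A, hA, φ, hφ, hφ'⟩
    obtain ⟨I, A, C, ι, ψ, hA, hι, hι', hψ, hψ'⟩ := mem_HSP_iff.1 hA
    exact mem_HSP_iff.2 ⟨I, A, C, ι, _, hA, hι, hι', hφ.comp hψ, hφ'.comp hψ'⟩
  closed_S := by
    rintro B ⟨A, hA, κ, hκ, hκ'⟩
    obtain ⟨I, A, C, ι, ψ, hA, hι, hι', hψ, hψ'⟩ := mem_HSP_iff.1 hA
    -- A subalgebra of a quotient of `C` is a quotient of its preimage in `C`.
    let D := pullback hψ hκ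
    have hD (d : D.toFrame) : ∃ b, κ b = ψ (D.incl d) := d.2
    choose ρ hρ using hD
    refine mem_HSP_iff.2 ⟨I, A, D.toFrame, _, ρ, hA, hι.comp D.isHom_incl,
      hι'.comp D.incl_injective, ⟨?_, ?_, ?_, ?_⟩, ?_⟩
    · intro x y
      apply hκ'
      rw [hκ.map_inf, hρ, hρ, hρ, D.isHom_incl.map_inf, hψ.map_inf]
    · intro x
      apply hκ'
      rw [hκ.map_compl, hρ, hρ, D.isHom_incl.map_compl, hψ.map_compl]
    · apply hκ'
      rw [hκ.map_bot, hρ, D.isHom_incl.map_bot, hψ.map_bot]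
    · intro x
      apply hκ'
      rw [hκ.map_op, hρ, hρ, D.isHom_incl.map_op, hψ.map_op]
    · intro b
      obtain ⟨c, hc⟩ := hψ' (κ b)
      exact ⟨⟨c, b, hc.symm⟩, hκ' ((hρ _).trans hc)⟩
  closed_P := by
    rintro B ⟨I, A, hA, χ, hχ, hχ'⟩
    choose J D C ι ψ hD hι hι' hψ hψ' using fun i => mem_HSP_iff.1 (hA i)
    obtain ⟨θ, hθ, hθ'⟩ := Function.bijective_iff_has_inverse.1 hχ'
    have hθh : IsHom (A := pi A) (B := B) θ := by
      refine ⟨fun x y => ?_, fun x => ?_, ?_, fun x => ?_⟩ <;> apply hχ'.1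
      · rw [hχ.map_inf, hθ', hθ', hθ']
      · rw [hχ.map_compl, hθ', hθ']
      · rw [hχ.map_bot, hθ']
      · rw [hχ.map_op, hθ', hθ']
    -- A product of products is one product over the sigma type of the indices.
    refine mem_HSP_iff.2 ⟨Σ i, J i, fun p => D p.1 p.2, pi C, fun x p => ι p.1 (x p.1) p.2,
      fun x => θ fun i => ψ i (x i), fun p => hD _ _, ?_, ?_, ?_, ?_⟩
    · exact isHom_pi fun p => (isHom_eval (D p.1) p.2).comp ((hι p.1).comp (isHom_eval C p.1))
    · intro x y h
      funext i
      exact hι' i (funext fun j => congrFun h ⟨i, j⟩)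
    · exact hθh.comp (A := pi C) (B := pi A) (isHom_pi fun i => (hψ i).comp (isHom_eval C i))
    · intro b
      choose x hx using fun i => hψ' i (χ b i)
      exact ⟨x, (congrArg θ (funext hx)).trans (hθ b)⟩

lemma IsVariety.pi_mem (hV : IsVariety V) {I : Type u} {A : I → BooleanFrame.{u}}
    (hA : ∀ i, A i ∈ V) : pi A ∈ V :=
  hV.closed_P ⟨I, A, hA, _, IsHom.id, Function.bijective_id⟩

lemma IsVariety.mem_of_subsingleton (hV : IsVariety V) [Subsingleton B] : B ∈ V :=
  hV.closed_P ⟨PEmpty, PEmpty.elim, fun i => i.elim, fun _ i => i.elim,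
    ⟨fun _ _ => funext fun i => i.elim, fun _ => funext fun i => i.elim,
      funext fun i => i.elim, fun _ => funext fun i => i.elim⟩,
    fun _ _ _ => Subsingleton.elim _ _, fun _ => ⟨⊥, funext fun i => i.elim⟩⟩

/-- A quotient of a Boolean reduct that is represented in a product of members of a variety
lies in the variety if the operation can be followed along representatives. -/
lemma IsVariety.mem_of_boolean_span (hV : IsVariety V) {C D A : BooleanFrame.{u}} (hD : D ∈ V)
    {R : C → D} {Q : C → A}
    (R_inf : ∀ x y, R (x ⊓ y) = R x ⊓ R y) (R_compl : ∀ x, R xᶜ = (R x)ᶜ) (R_bot : R ⊥ = ⊥)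
    (Q_inf : ∀ x y, Q (x ⊓ y) = Q x ⊓ Q y) (Q_compl : ∀ x, Q xᶜ = (Q x)ᶜ) (Q_bot : Q ⊥ = ⊥)
    (hQ : Function.Surjective Q) (hRQ : ∀ x y, R x = R y → Q x = Q y)
    (hop : ∀ x, ∃ y, R y = D.op (R x) ∧ Q y = A.op (Q x)) : A ∈ V := by
  have R_sup (x y) : R (x ⊔ y) = R x ⊔ R y := by
    rw [← compl_inj_iff, ← R_compl, compl_sup, compl_sup, R_inf, R_compl, R_compl]
  -- Neither `R` nor `Q` need commute with the operation; `hop` alone makes the range of `R` closed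
  -- under it. `Q` then factors through this range as a homomorphism onto `A`.
  let E : Subframe D :=
    { carrier := Set.range R
      supClosed' := by
        rintro _ ⟨x, rfl⟩ _ ⟨y, rfl⟩
        exact ⟨x ⊔ y, R_sup x y⟩
      infClosed' := by
        rintro _ ⟨x, rfl⟩ _ ⟨y, rfl⟩
        exact ⟨x ⊓ y, R_inf x y⟩
      compl_mem' := by
        rintro _ ⟨x, rfl⟩
        exact ⟨xᶜ, R_compl x⟩
      bot_mem' := ⟨⊥, R_bot⟩
      op_mem := by
        rintro _ ⟨x, rfl⟩
        obtain ⟨y, hy, -⟩ := hop x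
        exact ⟨y, hy⟩ }
  have hE (d : E.toFrame) : ∃ x, R x = E.incl d := d.2
  choose σ hσ using hE
  have key (d : E.toFrame) (x : C) (h : R x = E.incl d) : Q (σ d) = Q x :=
    hRQ _ _ ((hσ d).trans h.symm)
  refine hV.closed_H ⟨E.toFrame, hV.closed_S ⟨D, hD, E.incl, E.isHom_incl, E.incl_injective⟩,
    fun d => Q (σ d), ⟨fun x y => ?_, fun x => ?_, ?_, fun x => ?_⟩, fun a => ?_⟩
  · rw [← Q_inf]
    exact key _ _ (by rw [R_inf, hσ, hσ, E.isHom_incl.map_inf])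
  · rw [← Q_compl]
    exact key _ _ (by rw [R_compl, hσ, E.isHom_incl.map_compl])
  · rw [← Q_bot]
    exact key _ _ (by rw [R_bot, E.isHom_incl.map_bot])
  · obtain ⟨y, hy, hy'⟩ := hop (σ x)
    rw [← hy']
    exact key _ _ (by rw [hy, hσ, E.isHom_incl.map_op])
  · obtain ⟨x, rfl⟩ := hQ a
    exact ⟨⟨R x, x, rfl⟩, key _ _ rfl⟩

end HSP

/-! ### Preservation of the five properties under `HSP` -/

section Identities

variable {K : Set BooleanFrame.{u}}

/-- A property inherited by images, embedded algebras and products passes from `K` to `HSP K`. -/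
lemma HSP_induction {Q : BooleanFrame.{u} → Prop}
    (hH : ∀ {A B : BooleanFrame.{u}} (φ : A → B), IsHom φ → Function.Surjective φ → Q A → Q B)
    (hS : ∀ {A B : BooleanFrame.{u}} (φ : B → A), IsHom φ → Function.Injective φ → Q A → Q B)
    (hP : ∀ {I : Type u} (A : I → BooleanFrame.{u}), (∀ i, Q (A i)) → Q (pi A))
    (hK : ∀ A ∈ K, Q A) : ∀ A ∈ H (S (P K)), Q A := by
  intro B hB
  obtain ⟨I, A, C, ι, φ, hA, hι, hι', hφ, hφ'⟩ := mem_HSP_iff.1 hB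
  exact hH φ hφ hφ' (hS ι hι hι' (hP A fun i => hK _ (hA i)))

lemma isNormal_HSP (hK : ∀ A ∈ K, IsNormal A) : ∀ A ∈ H (S (P K)), IsNormal A := by
  refine HSP_induction ?_ ?_ ?_ hK
  · intro A B φ hφ _ h
    rw [IsNormal, ← hφ.map_bot, ← hφ.map_op, h]
  · intro A B φ hφ hφ' h
    exact hφ' (by rw [hφ.map_op, hφ.map_bot, h])
  · exact fun A h => funext fun i => h i

lemma isUnitPreserving_HSP (hK : ∀ A ∈ K, IsUnitPreserving A) :
    ∀ A ∈ H (S (P K)), IsUnitPreserving A := by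
  refine HSP_induction ?_ ?_ ?_ hK
  · intro A B φ hφ _ h
    rw [IsUnitPreserving, ← hφ.map_top, ← hφ.map_op, h]
  · intro A B φ hφ hφ' h
    exact hφ' (by rw [hφ.map_op, hφ.map_top, h])
  · exact fun A h => funext fun i => h i

lemma isExtensive_HSP (hK : ∀ A ∈ K, IsExtensive A) : ∀ A ∈ H (S (P K)), IsExtensive A := by
  refine HSP_induction ?_ ?_ ?_ hK
  · intro A B φ hφ hφ' h x
    obtain ⟨x, rfl⟩ := hφ' x
    rw [← hφ.map_op, ← inf_eq_left, ← hφ.map_inf, inf_eq_left.2 (h x)]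
  · intro A B φ hφ hφ' h x
    rw [← inf_eq_left]
    exact hφ' (by rw [hφ.map_inf, hφ.map_op, inf_eq_left.2 (h _)])
  · exact fun A h x i => h i (x i)

lemma isMonotone_HSP (hK : ∀ A ∈ K, IsMonotone A) : ∀ A ∈ H (S (P K)), IsMonotone A := by
  refine HSP_induction ?_ ?_ ?_ hK
  · intro A B φ hφ hφ' h x y
    obtain ⟨x, rfl⟩ := hφ' x
    obtain ⟨y, rfl⟩ := hφ' y
    rw [← hφ.map_op, ← hφ.map_op, ← hφ.map_sup, ← hφ.map_sup, ← hφ.map_op, ← inf_eq_left,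
      ← hφ.map_inf, inf_eq_left.2 (h x y)]
  · intro A B φ hφ hφ' h x y
    rw [← inf_eq_left]
    exact hφ' (by simp only [hφ.map_inf, hφ.map_op, hφ.map_sup, inf_eq_left.2 (h _ _)])
  · exact fun A h x y i => h i (x i) (y i)

lemma isIdempotent_HSP (hK : ∀ A ∈ K, IsIdempotent A) : ∀ A ∈ H (S (P K)), IsIdempotent A := by
  refine HSP_induction ?_ ?_ ?_ hK
  · intro A B φ hφ hφ' h x
    obtain ⟨x, rfl⟩ := hφ' x
    rw [← hφ.map_op, ← hφ.map_op, h]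
  · intro A B φ hφ hφ' h x
    exact hφ' (by simp only [hφ.map_op, h _])
  · exact fun A h x => funext fun i => h i (x i)

end Identities

/-! ### The star construction and the failure of the CEP -/

section Star

variable {A : BooleanFrame.{u}}

/-- The element of `star A` with the given coordinates. -/
def starMk (a b : A) : star A := (a, b)

lemma star_eta (x : star A) : x = starMk x.1 x.2 := rfl

@[simp] lemma starMk_inf (a b c d : A) : starMk a b ⊓ starMk c d = starMk (a ⊓ c) (b ⊓ d) := rfl

@[simp] lemma starMk_sup (a b c d : A) : starMk a b ⊔ starMk c d = starMk (a ⊔ c) (b ⊔ d) := rfl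

@[simp] lemma starMk_sdiff (a b c d : A) :
    starMk a b \ starMk c d = starMk (a \ c) (b \ d) := by
  rw [sdiff_eq, sdiff_eq, sdiff_eq]; rfl

@[simp] lemma starMk_compl (a b : A) : (starMk a b)ᶜ = starMk aᶜ bᶜ := rfl

lemma star_bot : (⊥ : star A) = starMk ⊥ ⊥ := rfl

lemma star_top : (⊤ : star A) = starMk ⊤ ⊤ := rfl

@[simp] lemma starMk_inj {a b c d : A} : starMk a b = starMk c d ↔ a = c ∧ b = d := Prod.mk_inj

lemma star_op_of_ne {a b : A} (ha : a ≠ ⊥) (hb : b ≠ ⊥) : (star A).op (starMk a b) = ⊤ :=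
  if_neg (not_or.2 ⟨ha, hb⟩)

lemma star_op_right (h : IsNormal A) (a : A) : (star A).op (starMk a ⊥) = starMk (A.op a) ⊥ := by
  refine (if_pos (Or.inr rfl)).trans ?_
  exact congrArg (starMk (A.op a)) h

lemma star_op_left (h : IsNormal A) (a : A) : (star A).op (starMk ⊥ a) = starMk ⊥ (A.op a) := by
  refine (if_pos (Or.inl rfl)).trans ?_
  exact congrArg (fun b => starMk b (A.op a)) h

lemma star_isNormal (h : IsNormal A) : IsNormal (star A) := by
  rw [IsNormal, star_bot, star_op_right h, h]

lemma star_isUnitPreserving (A : BooleanFrame.{u}) : IsUnitPreserving (star A) := by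
  by_cases ht : (⊤ : A) = ⊥
  · have : Subsingleton A := subsingleton_of_bot_eq_top ht.symm
    exact starMk_inj.2 ⟨Subsingleton.elim _ _, Subsingleton.elim _ _⟩
  · exact star_op_of_ne ht ht

lemma star_isExtensive_iff (h : IsNormal A) : IsExtensive (star A) ↔ IsExtensive A := by
  refine ⟨fun H a => ?_, fun H x => ?_⟩
  · have := H (starMk a ⊥)
    rw [star_op_right h] at this
    exact this.1
  · rw [star_eta x]
    by_cases h1 : x.1 = ⊥
    · rw [h1, star_op_left h]
      exact ⟨le_rfl, H _⟩
    by_cases h2 : x.2 = ⊥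
    · rw [h2, star_op_right h]
      exact ⟨H _, le_rfl⟩
    rw [star_op_of_ne h1 h2]
    exact le_top

lemma star_isMonotone_iff (h : IsNormal A) : IsMonotone (star A) ↔ IsMonotone A := by
  refine ⟨fun H a b => ?_, fun H x y => ?_⟩
  · have := H (starMk a ⊥) (starMk b ⊥)
    rw [starMk_sup, bot_sup_eq, star_op_right h, star_op_right h, star_op_right h] at this
    exact this.1
  · rw [star_eta x, star_eta y, starMk_sup]
    -- Only the join matters: off the axes its value is `⊤`, and if it lies on an axis, so do both
    -- arguments.
    by_cases h1 : x.1 ⊔ y.1 = ⊥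
    · rw [h1]
      rw [sup_eq_bot_iff] at h1
      rw [h1.1, h1.2, star_op_left h, star_op_left h, star_op_left h, starMk_sup]
      exact ⟨(sup_idem _).le, H _ _⟩
    by_cases h2 : x.2 ⊔ y.2 = ⊥
    · rw [h2]
      rw [sup_eq_bot_iff] at h2
      rw [h2.1, h2.2, star_op_right h, star_op_right h, star_op_right h, starMk_sup]
      exact ⟨H _ _, (sup_idem _).le⟩
    rw [star_op_of_ne h1 h2]
    exact le_top

lemma star_isIdempotent_iff (h : IsNormal A) :
    IsIdempotent (star A) ↔ IsIdempotent A := by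
  refine ⟨fun H a => ?_, fun H x => ?_⟩
  · have := H (starMk a ⊥)
    rw [star_op_right h, star_op_right h] at this
    exact (starMk_inj.1 this).1
  · rw [star_eta x]
    by_cases h1 : x.1 = ⊥
    · rw [h1, star_op_left h, star_op_left h, H]
    by_cases h2 : x.2 = ⊥
    · rw [h2, star_op_right h, star_op_right h, H]
    rw [star_op_of_ne h1 h2]
    exact star_isUnitPreserving A

lemma star_op_corner (h : IsNormal A) (h' : IsUnitPreserving A) {a b : A}
    (ha : a = ⊥ ∨ a = ⊤) (hb : b = ⊥ ∨ b = ⊤) : (star A).op (starMk a b) = starMk a b := by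
  rcases ha with rfl | rfl
  · rcases hb with rfl | rfl
    · exact star_isNormal h
    · rw [star_op_left h, h']
  · rcases hb with rfl | rfl
    · rw [star_op_right h, h']
    · exact star_isUnitPreserving A

/-- The four-element subalgebra `{⊥, ⊤} × {⊥, ⊤}` of `star A`. -/
def cornerSubframe (h : IsNormal A) (h' : IsUnitPreserving A) : Subframe (star A) where
  carrier := {x | (x.1 = ⊥ ∨ x.1 = ⊤) ∧ (x.2 = ⊥ ∨ x.2 = ⊤)}
  supClosed' := by
    rintro ⟨a, b⟩ ⟨ha, hb⟩ ⟨c, d⟩ ⟨hc, hd⟩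
    change (a ⊔ c = ⊥ ∨ a ⊔ c = ⊤) ∧ (b ⊔ d = ⊥ ∨ b ⊔ d = ⊤)
    dsimp only at ha hb hc hd
    constructor
    · rcases ha with rfl | rfl <;> rcases hc with rfl | rfl <;> simp
    · rcases hb with rfl | rfl <;> rcases hd with rfl | rfl <;> simp
  infClosed' := by
    rintro ⟨a, b⟩ ⟨ha, hb⟩ ⟨c, d⟩ ⟨hc, hd⟩
    change (a ⊓ c = ⊥ ∨ a ⊓ c = ⊤) ∧ (b ⊓ d = ⊥ ∨ b ⊓ d = ⊤)
    dsimp only at ha hb hc hd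
    constructor
    · rcases ha with rfl | rfl <;> rcases hc with rfl | rfl <;> simp
    · rcases hb with rfl | rfl <;> rcases hd with rfl | rfl <;> simp
  compl_mem' := by
    rintro ⟨a, b⟩ ⟨ha, hb⟩
    change (aᶜ = ⊥ ∨ aᶜ = ⊤) ∧ (bᶜ = ⊥ ∨ bᶜ = ⊤)
    dsimp only at ha hb
    constructor
    · rcases ha with rfl | rfl <;> simp
    · rcases hb with rfl | rfl <;> simp
  bot_mem' := ⟨Or.inl rfl, Or.inl rfl⟩
  op_mem := by
    rintro ⟨a, b⟩ ⟨ha, hb⟩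
    suffices (star A).op (starMk a b) = starMk a b from this ▸ ⟨ha, hb⟩
    exact star_op_corner h h' ha hb

lemma cornerSubframe_op (h : IsNormal A) (h' : IsUnitPreserving A)
    (x : (cornerSubframe h h').toFrame) : (cornerSubframe h h').toFrame.op x = x := by
  obtain ⟨⟨a, b⟩, ha, hb⟩ := x
  exact Subtype.ext (star_op_corner h h' ha hb)

/-- A fixed point of the operation other than `⊥` and `⊤`, whose complement is fixed too,
spoils the congruence extension property of `star A`. -/
lemma not_hasCEP_star (h : IsNormal A) (h' : IsUnitPreserving A) {b : A} (hb : b ≠ ⊥)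
    (hb' : b ≠ ⊤) (hfb : A.op b = b) (hfb' : A.op bᶜ = bᶜ) : ¬ HasCEP (star A) := by
  intro H
  let E := cornerSubframe h h'
  -- The kernel of the first projection, compatible with the operation because that is the identity
  -- on the corners.
  let Θ : Congruence E.toFrame :=
    { r := fun x y => (E.incl x).1 = (E.incl y).1
      iseqv := ⟨fun _ => rfl, fun h => h.symm, fun h h' => h.trans h'⟩
      inf_compat := fun {x x' y y'} hx hy => congrArg₂ (fun a b : A => a ⊓ b) hx hy
      compl_compat := fun {x x'} hx => congrArg (fun a : A => aᶜ) hx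
      op_compat := fun {x x'} hx => by
        rw [cornerSubframe_op h h' x, cornerSubframe_op h h' x']
        exact hx }
  obtain ⟨Ψ, hΨ⟩ := H E Θ
  have h1 : Ψ.r (starMk ⊤ ⊥) (starMk ⊤ ⊤) :=
    (hΨ ⟨starMk ⊤ ⊥, Or.inr rfl, Or.inl rfl⟩ ⟨starMk ⊤ ⊤, Or.inr rfl, Or.inr rfl⟩).1 rfl
  have collapse (c : A) (hc : c ≠ ⊥) (hfc : A.op c = c) :
      Ψ.r (starMk c ⊥) (starMk ⊤ ⊥) := by
    -- This gives `(c, ⊥) ~ (c, ⊤)`; the operation fixes the first, on an axis, and sends the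
    -- second, off the axes, to `⊤`.
    have h2 := Ψ.inf_compat h1 (Ψ.iseqv.refl (starMk c ⊤))
    simp only [starMk_inf, top_inf_eq, inf_top_eq] at h2
    have ht : (⊤ : A) ≠ ⊥ := fun ht => hc (le_bot_iff.1 (ht ▸ le_top))
    have h3 := Ψ.op_compat h2
    rw [star_op_right h, star_op_of_ne hc ht, hfc] at h3
    exact Ψ.iseqv.trans h3 (Ψ.iseqv.symm h1)
  have h4 := Ψ.inf_compat (collapse b hb hfb)
    (collapse bᶜ (fun hc => hb' (compl_eq_bot.1 hc)) hfb')
  simp only [starMk_inf, inf_compl_self, inf_idem] at h4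
  have h5 : (⊥ : A) = ⊤ := (hΨ ⟨starMk ⊥ ⊥, Or.inl rfl, Or.inl rfl⟩
    ⟨starMk ⊤ ⊥, Or.inr rfl, Or.inl rfl⟩).2 h4
  exact hb (le_bot_iff.1 (h5 ▸ le_top))

end Star

/-! ### Recovering a frame from its star by a corner-valued term -/

section Relativization

/-- A term that, in an algebra `star A`, takes only the values `(⊤, ⊥)`, `(⊥, ⊤)` and `⊥`. -/
def cornerTerm (A : BooleanFrame.{u}) (c b : A) : A :=
  let g := c \ A.op cᶜ
  let z := (A.op g)ᶜ
  g ⊓ A.op (z ⊔ (A.op (b ⊔ z) ⊓ g) \ A.op b)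

variable {A B : BooleanFrame.{u}}

lemma IsHom.map_cornerTerm {φ : A → B} (h : IsHom φ) (c b : A) :
    φ (cornerTerm A c b) = cornerTerm B (φ c) (φ b) := by
  simp only [cornerTerm, h.map_inf, h.map_sup, h.map_sdiff, h.map_compl, h.map_op]

lemma cornerTerm_of_op_eq_top (h : IsNormal A) {c b : A} (hc : A.op (c \ A.op cᶜ) = ⊤) :
    cornerTerm A c b = ⊥ := by
  simp only [cornerTerm, hc, compl_top, sup_bot_eq, bot_sup_eq]
  rw [sdiff_eq_bot_iff.2 (inf_le_left : A.op b ⊓ _ ≤ A.op b), h, inf_bot_eq]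

lemma cornerTerm_of_eq_bot {c b : A} (hc : c \ A.op cᶜ = ⊥) : cornerTerm A c b = ⊥ := by
  simp only [cornerTerm, hc, bot_inf_eq]

/-- If `c` has no coordinate `⊤`, then `g = ⊥`. Otherwise `g` has a coordinate `⊤`; if the other one
is not `⊥`, then `z = ⊥` and the term vanishes. If it is `⊥`, then `g` is an axis corner and `z` the
opposite one, so the outer operation gives `⊤` or `z`, and the meet with `g` is `g` or `⊥`. -/
lemma cornerTerm_star_mem (h : IsNormal A) (h' : IsUnitPreserving A) (c b : star A) :
    cornerTerm (star A) c b = ⊥ ∨ cornerTerm (star A) c b = starMk ⊤ ⊥ ∨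
      cornerTerm (star A) c b = starMk ⊥ ⊤ := by
  rcases subsingleton_or_nontrivial A with _ | _
  · exact Or.inl (starMk_inj.2 ⟨Subsingleton.elim _ _, Subsingleton.elim _ _⟩)
  have ht : (⊤ : A) ≠ ⊥ := top_ne_bot
  obtain ⟨p, q, rfl⟩ : ∃ p q, c = starMk p q := ⟨_, _, rfl⟩
  by_cases hp : pᶜ = ⊥
  · obtain ⟨r, hr⟩ : ∃ r, starMk p q \ (star A).op (starMk p q)ᶜ = starMk ⊤ r := by
      obtain rfl := compl_eq_bot.1 hp
      rw [starMk_compl, compl_top, star_op_left h, starMk_sdiff, sdiff_bot]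
      exact ⟨_, rfl⟩
    by_cases hr0 : r = ⊥
    · have hz : ((star A).op (starMk ⊤ r))ᶜ = starMk ⊥ ⊤ := by
        rw [hr0, star_op_right h, show A.op ⊤ = ⊤ from h', starMk_compl, compl_top, compl_bot]
      simp only [cornerTerm, hr, hz]
      generalize ((star A).op (b ⊔ starMk ⊥ ⊤) ⊓ starMk ⊤ r) \ (star A).op b = y
      rw [star_eta y, starMk_sup, top_sup_eq, bot_sup_eq, hr0]
      by_cases hy : y.1 = ⊥
      · left
        rw [hy, star_op_left h, starMk_inf, inf_bot_eq, bot_inf_eq, star_bot]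
      · right; left
        rw [star_op_of_ne hy ht, inf_top_eq]
    · exact Or.inl (cornerTerm_of_op_eq_top (star_isNormal h) (by rw [hr, star_op_of_ne ht hr0]))
  by_cases hq : qᶜ = ⊥
  · obtain ⟨r, hr⟩ : ∃ r, starMk p q \ (star A).op (starMk p q)ᶜ = starMk r ⊤ := by
      obtain rfl := compl_eq_bot.1 hq
      rw [starMk_compl, compl_top, star_op_right h, starMk_sdiff, sdiff_bot]
      exact ⟨_, rfl⟩
    by_cases hr0 : r = ⊥
    · have hz : ((star A).op (starMk r ⊤))ᶜ = starMk ⊤ ⊥ := by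
        rw [hr0, star_op_left h, show A.op ⊤ = ⊤ from h', starMk_compl, compl_top, compl_bot]
      simp only [cornerTerm, hr, hz]
      generalize ((star A).op (b ⊔ starMk ⊤ ⊥) ⊓ starMk r ⊤) \ (star A).op b = y
      rw [star_eta y, starMk_sup, top_sup_eq, bot_sup_eq, hr0]
      by_cases hy : y.2 = ⊥
      · left
        rw [hy, star_op_right h, starMk_inf, inf_bot_eq, bot_inf_eq, star_bot]
      · right; right
        rw [star_op_of_ne ht hy, inf_top_eq]
    · exact Or.inl (cornerTerm_of_op_eq_top (star_isNormal h) (by rw [hr, star_op_of_ne hr0 ht]))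
  exact Or.inl (cornerTerm_of_eq_bot (by
    rw [starMk_compl, star_op_of_ne hp hq, sdiff_top]))

/-- Here `z = (⊥, ⊤)`. Joining it to `(b, ⊥)` leaves the axes since `b ≠ ⊥`, and the difference `((f
b)ᶜ, ⊥)`, nonzero since `f b ≠ ⊤`, joined to `z` does so again. -/
lemma cornerTerm_star_eq (h : IsNormal A) (h' : IsUnitPreserving A) {b : A} (hb : b ≠ ⊥)
    (hb' : A.op b ≠ ⊤) : cornerTerm (star A) (starMk ⊤ ⊥) (starMk b ⊥) = starMk ⊤ ⊥ := by
  have ht : (⊤ : A) ≠ ⊥ := fun ht => hb (le_bot_iff.1 (ht ▸ le_top))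
  have hc : (A.op b)ᶜ ≠ ⊥ := fun hc => hb' (compl_eq_bot.1 hc)
  simp [cornerTerm, star_op_left h, star_op_right h, show A.op ⊤ = ⊤ from h',
    star_op_of_ne hb ht, star_op_of_ne hc ht, star_top]

/-- A frame with an element `b ≠ ⊥` such that `op b ≠ ⊤` lies in `U` once its star lies in the
star variety of `U`. -/
lemma mem_of_star_mem {U : Set BooleanFrame.{u}} (hU : IsNUVariety U) (h : IsNormal A)
    (h' : IsUnitPreserving A) {b : A} (hb : b ≠ ⊥) (hb' : A.op b ≠ ⊤)
    (hA : star A ∈ starVariety U) : A ∈ U := by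
  obtain ⟨I, D, C, ι, φ, hD, hι, hι', hφ, hφ'⟩ := mem_HSP_iff.1 hA
  choose B hB hDB using hD
  obtain rfl : D = fun i => star (B i) := funext hDB
  obtain ⟨γ, hγ⟩ := hφ' (starMk ⊤ ⊥)
  obtain ⟨β, hβ⟩ := hφ' (starMk b ⊥)
  set e := cornerTerm C γ β with he
  have hφe : φ e = starMk ⊤ ⊥ := by
    rw [he, hφ.map_cornerTerm, hγ, hβ, cornerTerm_star_eq h h' hb hb']
  have hιi (i : I) : IsHom (fun x => (ι x i : star (B i))) :=
    (isHom_eval (fun i => star (B i)) i).comp hι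
  have hιe (i : I) : (ι e i : star (B i)) = ⊥ ∨ (ι e i : star (B i)) = starMk ⊤ ⊥ ∨
      (ι e i : star (B i)) = starMk ⊥ ⊤ := by
    have := (hιi i).map_cornerTerm γ β
    rw [← he] at this
    rw [this]
    exact cornerTerm_star_mem (hU.normal _ (hB i)) (hU.unitPreserving _ (hB i)) _ _
  -- Indices where `e` is `⊥` are dropped; at the others `e` selects one copy of `B i`, which `R`
  -- reads off.
  let J₁ := {i : I // (ι e i : star (B i)) = starMk ⊤ ⊥}
  let J₂ := {i : I // (ι e i : star (B i)) = starMk ⊥ ⊤}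
  let D : J₁ ⊕ J₂ → BooleanFrame.{u} := Sum.elim (fun j => B j.1) (fun j => B j.1)
  have hDU : ∀ j, D j ∈ U := by
    rintro (j | j)
    exacts [hB _, hB _]
  let R : C → pi D := fun x j => match j with
    | .inl j => (ι x j.1).1
    | .inr j => (ι x j.1).2
  let Q : C → A := fun x => (φ x).1
  refine hU.isVariety.mem_of_boolean_span (hU.isVariety.pi_mem hDU) (R := R) (Q := Q)
    ?_ ?_ ?_ ?_ ?_ ?_ ?_ ?_ ?_
  · intro x y
    funext j
    rcases j with j | j
    exacts [congrArg Prod.fst ((hιi j.1).map_inf x y), congrArg Prod.snd ((hιi j.1).map_inf x y)]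
  · intro x
    funext j
    rcases j with j | j
    exacts [congrArg Prod.fst ((hιi j.1).map_compl x), congrArg Prod.snd ((hιi j.1).map_compl x)]
  · funext j
    rcases j with j | j
    exacts [congrArg Prod.fst (hιi j.1).map_bot, congrArg Prod.snd (hιi j.1).map_bot]
  · exact fun x y => congrArg Prod.fst (hφ.map_inf x y)
  · exact fun x => congrArg Prod.fst (hφ.map_compl x)
  · exact congrArg Prod.fst hφ.map_bot
  · intro a
    obtain ⟨x, hx⟩ := hφ' (starMk a ⊥)
    exact ⟨x, congrArg Prod.fst hx⟩
  · intro x y hxy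
    -- `R` determines `x ⊓ e`, and `φ (x ⊓ e) = (Q x, ⊥)`.
    have hxe : x ⊓ e = y ⊓ e := by
      apply hι'
      funext i
      refine ((hιi i).map_inf x e).trans (Eq.trans ?_ ((hιi i).map_inf y e).symm)
      rw [star_eta (ι x i), star_eta (ι y i)]
      rcases hιe i with hi | hi | hi <;> simp only [hi]
      · rw [inf_bot_eq, inf_bot_eq]
      · have : (ι x i).1 = (ι y i).1 := congrFun hxy (Sum.inl ⟨i, hi⟩)
        rw [this]; simp
      · have : (ι x i).2 = (ι y i).2 := congrFun hxy (Sum.inr ⟨i, hi⟩)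
        rw [this]; simp
    have := congrArg φ hxe
    rw [hφ.map_inf, hφ.map_inf, hφe, star_eta (φ x), star_eta (φ y), starMk_inf, starMk_inf,
      inf_top_eq, inf_top_eq] at this
    exact (starMk_inj.1 this).1
  · intro x
    -- Meeting with `e` first moves every relevant coordinate onto an axis, where the operation is
    -- the original one.
    refine ⟨C.op (x ⊓ e), ?_, ?_⟩
    · funext j
      rcases j with j | j
      · have := (hιi j.1).map_op (x ⊓ e)
        rw [(hιi j.1).map_inf, j.2, star_eta (ι x j.1), starMk_inf, inf_top_eq, inf_bot_eq,
          star_op_right (hU.normal _ (hB j.1))] at this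
        exact congrArg Prod.fst this
      · have := (hιi j.1).map_op (x ⊓ e)
        rw [(hιi j.1).map_inf, j.2, star_eta (ι x j.1), starMk_inf, inf_top_eq, inf_bot_eq,
          star_op_left (hU.normal _ (hB j.1))] at this
        exact congrArg Prod.snd this
    · have := hφ.map_op (x ⊓ e)
      rw [hφ.map_inf, hφe, star_eta (φ x), starMk_inf, inf_top_eq, inf_bot_eq,
        star_op_right h] at this
      exact congrArg Prod.fst this

end Relativization

/-! ### Passing to squares; the statements for varieties -/

section StarVariety

variable {V U : Set BooleanFrame.{u}}

lemma star_mem_starVariety {A : BooleanFrame.{u}} (hA : A ∈ V) : star A ∈ starVariety V :=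
  subset_HSP ⟨A, hA, rfl⟩

lemma isNUVariety_starVariety (hV : IsNUVariety V) : IsNUVariety (starVariety V) where
  isVariety := isVariety_HSP _
  normal := isNormal_HSP <| by
    rintro _ ⟨A, hA, rfl⟩
    exact star_isNormal (hV.normal A hA)
  unitPreserving := isUnitPreserving_HSP <| by
    rintro _ ⟨A, hA, rfl⟩
    exact star_isUnitPreserving A

/-- The square of a frame. -/
def square (A : BooleanFrame.{u}) : BooleanFrame.{u} := pi fun _ : ULift.{u} Bool => A

/-- The element `(⊤, ⊥)` of the square. -/
def squareCorner (A : BooleanFrame.{u}) : square A := fun i => if i.down then ⊤ else ⊥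

lemma squareCorner_ne_bot (A : BooleanFrame.{u}) [Nontrivial A] : squareCorner A ≠ ⊥ :=
  fun h => top_ne_bot (α := A) (congrFun h ⟨true⟩)

lemma squareCorner_ne_top (A : BooleanFrame.{u}) [Nontrivial A] : squareCorner A ≠ ⊤ :=
  fun h => bot_ne_top (α := A) (congrFun h ⟨false⟩)

lemma square_op_squareCorner {A : BooleanFrame.{u}} (h : IsNormal A) (h' : IsUnitPreserving A) :
    (square A).op (squareCorner A) = squareCorner A := by
  funext ⟨i⟩
  cases i
  exacts [h, h']

lemma square_op_compl_squareCorner {A : BooleanFrame.{u}} (h : IsNormal A)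
    (h' : IsUnitPreserving A) : (square A).op (squareCorner A)ᶜ = (squareCorner A)ᶜ := by
  have ht : (squareCorner A)ᶜ = fun i : ULift.{u} Bool => if i.down then (⊥ : A) else ⊤ := by
    funext ⟨i⟩
    cases i
    exacts [compl_bot (α := A), compl_top (α := A)]
  rw [ht]
  funext ⟨i⟩
  cases i
  exacts [h', h]

lemma not_forall_hasCEP_starVariety (hV : IsNUVariety V) {A : BooleanFrame.{u}} (hA : A ∈ V)
    [Nontrivial A] : ¬ ∀ A ∈ starVariety V, A.HasCEP := by
  intro H
  have hA2 : square A ∈ V := hV.isVariety.pi_mem fun _ => hA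
  have h := hV.normal A hA
  have h' := hV.unitPreserving A hA
  exact not_hasCEP_star (hV.normal _ hA2) (hV.unitPreserving _ hA2) (squareCorner_ne_bot A)
    (squareCorner_ne_top A) (square_op_squareCorner h h') (square_op_compl_squareCorner h h')
    (H _ (star_mem_starVariety hA2))

lemma subset_of_starVariety_subset (hV : IsNUVariety V) (hU : IsNUVariety U)
    (hVU : starVariety V ⊆ starVariety U) : V ⊆ U := by
  intro A hA
  rcases subsingleton_or_nontrivial A with _ | _
  · exact hU.isVariety.mem_of_subsingleton
  have hA2 : square A ∈ V := hV.isVariety.pi_mem fun _ => hA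
  -- `A` itself may lack a suitable `b` (for instance with two elements), but it is an image of its
  -- square.
  refine hU.isVariety.closed_H ⟨square A, ?_, _, isHom_eval _ ⟨true⟩,
    fun a => ⟨fun _ => a, rfl⟩⟩
  refine mem_of_star_mem hU (hV.normal _ hA2) (hV.unitPreserving _ hA2) (squareCorner_ne_bot A)
    ?_ (hVU (star_mem_starVariety hA2))
  rw [square_op_squareCorner (hV.normal A hA) (hV.unitPreserving A hA)]
  exact squareCorner_ne_top A

end StarVariety

end BooleanFrame

theorem mainTheorem1 :
    (∀ V : Set BooleanFrame.{u}, BooleanFrame.IsNUVariety V →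
      BooleanFrame.IsNUVariety (BooleanFrame.starVariety V) ∧
      ((∃ A ∈ V, Nontrivial A) → ¬ ∀ A ∈ BooleanFrame.starVariety V, A.HasCEP) ∧
      ((∀ A ∈ BooleanFrame.starVariety V, A.IsExtensive) ↔ ∀ A ∈ V, A.IsExtensive) ∧
      ((∀ A ∈ BooleanFrame.starVariety V, A.IsMonotone) ↔ ∀ A ∈ V, A.IsMonotone) ∧
      ((∀ A ∈ BooleanFrame.starVariety V, A.IsIdempotent) ↔ ∀ A ∈ V, A.IsIdempotent)) ∧
    (∀ V U : Set BooleanFrame.{u}, BooleanFrame.IsNUVariety V → BooleanFrame.IsNUVariety U →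
      V ≠ U → BooleanFrame.starVariety V ≠ BooleanFrame.starVariety U) := by
  open BooleanFrame in
  refine ⟨fun V hV => ⟨isNUVariety_starVariety hV, ?_, ⟨fun H A hA => ?_, fun H => ?_⟩,
    ⟨fun H A hA => ?_, fun H => ?_⟩, ⟨fun H A hA => ?_, fun H => ?_⟩⟩, ?_⟩
  · rintro ⟨A, hA, _⟩
    exact not_forall_hasCEP_starVariety hV hA
  · exact (star_isExtensive_iff (hV.normal A hA)).1 (H _ (star_mem_starVariety hA))
  · apply isExtensive_HSP
    rintro _ ⟨A, hA, rfl⟩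
    exact (star_isExtensive_iff (hV.normal A hA)).2 (H A hA)
  · exact (star_isMonotone_iff (hV.normal A hA)).1 (H _ (star_mem_starVariety hA))
  · apply isMonotone_HSP
    rintro _ ⟨A, hA, rfl⟩
    exact (star_isMonotone_iff (hV.normal A hA)).2 (H A hA)
  · exact (star_isIdempotent_iff (hV.normal A hA)).1
      (H _ (star_mem_starVariety hA))
  · apply isIdempotent_HSP
    rintro _ ⟨A, hA, rfl⟩
    exact (star_isIdempotent_iff (hV.normal A hA)).2 (H A hA)
  · exact fun V U hV hU hne heq => hne (Set.Subset.antisymm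
      (subset_of_starVariety_subset hV hU heq.subset)
      (subset_of_starVariety_subset hU hV heq.symm.subset))
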